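/- Let $K$ be a number field of degree $n$ with $r$ real places and $s$ complex places ($n=r+2s$), discriminant $\Delta_K$, adele ring $\mathbb{A}_K$ and idele group $\mathbb{I}_K=\mathbb{A}_K^\times$. Embed $K$ diagonally in $\mathbb{A}_K$. For $a=(a_v)_v\in\mathbb{I}_K$ let $\Vert a\Vert=\prod_v|a_v|_v$ be the idele norm, with the normalized absolute values (the usual one at a real place, the square of the usual one at a complex place, and $|x|_v=(\mathbb{N}\mathfrak{p})^{-\mathrm{ord}_{\mathfrak p}(x)}$ at the finite place of a prime $\mathfrak{p}$). Let $$B=\prod_{v\ \text{finite}}\mathcal{O}_v\times\prod_{v\ \text{infinite}}\{x\in K_v:\ |x|\le 1\}\subset\mathbb{A}_K$$ be the product of the closed unit balls at all places (here $|\cdot|$ is the usual, unsquared absolute value of $\mathbb{R}$ or $\mathbb{C}$), and let $\chi_B$ be its characteristic function. Then for every idele $a$ the set $\{\alpha\in K:\ \alpha a^{-1}\in B\}$ is finite, and its cardinality satisfies $$\#\{\alpha\in K:\ \alpha a^{-1}\in B\}=\sum_{\alpha\in K}\chi_B(\alpha a^{-1})=\frac{2^r(2\pi)^s}{\sqrt{|\Delta_K|}}\,\Vert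 a\Vert+O\bigl(\Vert a\Vert^{1-1/n}\bigr)$$ uniformly over the ideles whose norm is bounded away from $0$; if $n=1$, uniformly over all ideles. That is: for every real $\delta>0$ there is a constant $C$, depending only on $K$ and $\delta$, such that for all $a\in\mathbb{I}_K$ with $\Vert a\Vert\ge\delta$ (and, if $n=1$, for all $a\in\mathbb{I}_K$) $$\left|\#\{\alpha\in K:\ \alpha a^{-1}\in B\}-\frac{2^r(2\pi)^s}{\sqrt{|\Delta_K|}}\,\Vert a\Vert\right|\le C\,\Vert a\Vert^{1-1/n}.$$ -/

import Mathlib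

open NumberField IsDedekindDomain
open scoped NumberField.AdeleRing

/-- The idele norm `‖a‖ = ∏ᵥ |aᵥ|ᵥ` over all places `v` of `K`, with the normalized absolute values:
`|x|` at a real place, `|x|²` at a complex place, and `N(𝔭) ^ (-ord x)` at the finite place of `𝔭`.
The product over the finite places is a product of finitely many factors different from `1`,
see `hasFiniteMulSupport_idele` below. -/
noncomputable def ideleNorm (K : Type*) [Field K] [NumberField K] (a : (𝔸[K])ˣ) : ℝ :=
  (∏ v : InfinitePlace K, ‖(a : 𝔸[K]).1 v‖ ^ v.mult) *
    ∏ᶠ v : HeightOneSpectrum (𝓞 K), ‖(a : 𝔸[K]).2 v‖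

theorem hasFiniteMulSupport_idele (K : Type*) [Field K] [NumberField K] (a : (𝔸[K])ˣ) :
    (Function.mulSupport fun v : HeightOneSpectrum (𝓞 K) => ‖(a : 𝔸[K]).2 v‖).Finite := by
  have h : IsUnit (a : 𝔸[K]).2 := a.isUnit.map (RingHom.snd (InfiniteAdeleRing K) 𝔸ᶠ[K])
  have h2 := (FiniteAdeleRing.isUnit_iff.1 h).2
  rw [Filter.eventually_cofinite] at h2
  refine h2.subset fun v hv hv1 => hv ?_
  simp [FinitePlace.norm_def, hv1]

/-- The product `B` of the closed unit balls of all completions of `K`, inside the adele ring: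
the valuation ring at each finite place, the closed unit interval or disc at each infinite place. -/
def adelicUnitBall (K : Type*) [Field K] [NumberField K] : Set 𝔸[K] :=
  {x | (∀ v : InfinitePlace K, ‖x.1 v‖ ≤ 1) ∧
    ∀ v : HeightOneSpectrum (𝓞 K), x.2 v ∈ v.adicCompletionIntegers K}

/-- The set of all `α ∈ K`, embedded diagonally into the adeles, with `α a⁻¹ ∈ B`. -/
def ideleSections (K : Type*) [Field K] [NumberField K] (a : (𝔸[K])ˣ) : Set K :=
  {α | algebraMap K 𝔸[K] α * ((a⁻¹ : (𝔸[K])ˣ) : 𝔸[K]) ∈ adelicUnitBall K}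

/-! An idele `a` gives a fractional ideal `I`, with `absNorm I` the inverse of the finite part of
`‖a‖`, and radii `t w = |a_w|`. The sections of `a` are the elements of `I` in the box of radii `t`,
so they are lattice points in a convex body. For fixed `I`, translates of a bounded fundamental
domain sandwich the count between volumes of boxes of radii `t ± d`
(`ncard_boundedSections_bounds`). The error is `O(N^(1-1/n))`, `N = ‖a‖`, provided every `t w` is at
least a constant times `N^(1/n)`. Minkowski's theorem removes this proviso: multiplying by an
element of `K` preserves count and norm, and can make the box balanced with `I` in a finite set
(`exists_finite_balanced_representatives`). Small norms matter only for `n = 1`; there, norm below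
`1` leaves only the section `0`. -/

/-! ### Lattice points and volumes. -/

section LatticeCount

open MeasureTheory

variable {E ι : Type*} [NormedAddCommGroup E] [NormedSpace ℝ E] [MeasurableSpace E] [BorelSpace E]
  [Fintype ι] (b : Module.Basis ι ℝ E) (μ : Measure E) [μ.IsAddLeftInvariant]

/-- Distinct lattice translates of the fundamental domain are disjoint, because `ZSpan.fract`
recovers the point of the domain. -/
theorem card_mul_measure_fundamentalDomain_le {s : Finset E} {D : Set E}
    (hs : ∀ x ∈ s, x ∈ Submodule.span ℤ (Set.range b))
    (hD : ∀ x ∈ s, ∀ y ∈ ZSpan.fundamentalDomain b, x + y ∈ D) :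
    s.card * μ (ZSpan.fundamentalDomain b) ≤ μ D := by
  have hdisj : (s : Set E).PairwiseDisjoint
      fun x => (fun y => x + y) '' ZSpan.fundamentalDomain b := by
    intro x hx x' hx' hne
    refine Set.disjoint_left.2 ?_
    rintro _ ⟨y, hy, rfl⟩ ⟨y', hy', h⟩
    have h2 : ZSpan.fract b (x' + y') = ZSpan.fract b (x + y) := congrArg _ h
    rw [ZSpan.fract_zSpan_add _ _ (hs x hx), ZSpan.fract_zSpan_add _ _ (hs x' hx'),
      ZSpan.fract_eq_self.2 hy, ZSpan.fract_eq_self.2 hy'] at h2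
    subst h2
    exact hne (add_right_cancel h).symm
  have hmeas : ∀ x ∈ s, MeasurableSet ((fun y => x + y) '' ZSpan.fundamentalDomain b) :=
    fun x _ => (MeasurableEquiv.addLeft x).measurableSet_image.2
      (ZSpan.fundamentalDomain_measurableSet b)
  calc s.card * μ (ZSpan.fundamentalDomain b)
      = ∑ x ∈ s, μ ((fun y => x + y) '' ZSpan.fundamentalDomain b) := by
        simp [Set.image_add_left, measure_preimage_add]
    _ = μ (⋃ x ∈ s, (fun y => x + y) '' ZSpan.fundamentalDomain b) :=
        (measure_biUnion_finset hdisj hmeas).symm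
    _ ≤ μ D := by
        refine measure_mono (Set.iUnion₂_subset fun x hx => ?_)
        rintro _ ⟨y, hy, rfl⟩
        exact hD x hx y hy

theorem measure_le_card_mul_measure_fundamentalDomain {s : Finset E} {D : Set E}
    (hD : ∀ z ∈ D, (ZSpan.floor b z : E) ∈ s) :
    μ D ≤ s.card * μ (ZSpan.fundamentalDomain b) := by
  calc μ D ≤ μ (⋃ x ∈ s, (fun y => x + y) '' ZSpan.fundamentalDomain b) := by
        refine measure_mono fun z hz => Set.mem_iUnion₂.2 ⟨_, hD z hz, ZSpan.fract b z,
          ZSpan.fract_mem_fundamentalDomain b z, ?_⟩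
        simp [ZSpan.fract_apply]
    _ ≤ ∑ x ∈ s, μ ((fun y => x + y) '' ZSpan.fundamentalDomain b) :=
        measure_biUnion_finset_le _ _
    _ = s.card * μ (ZSpan.fundamentalDomain b) := by
        simp [Set.image_add_left, measure_preimage_add]

end LatticeCount

/-! ### Elements of a fixed fractional ideal in a box. -/

namespace NumberField

open InfinitePlace mixedEmbedding Module
open scoped nonZeroDivisors NNReal

variable (K : Type*) [Field K]

theorem mixedEmbedding.mem_convexBodyLT_iff {f : InfinitePlace K → ℝ≥0} {x : mixedSpace K} :
    x ∈ convexBodyLT K f ↔ ∀ w, normAtPlace w x < f w := by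
  simp only [Set.mem_prod, Set.mem_pi, Set.mem_univ, mem_ball_zero_iff, true_implies,
    Subtype.forall]
  constructor
  · rintro ⟨h₁, h₂⟩ w
    rcases isReal_or_isComplex w with h | h
    · rw [normAtPlace_apply_of_isReal h]; exact h₁ w h
    · rw [normAtPlace_apply_of_isComplex h]; exact h₂ w h
  · refine fun h => ⟨fun w hw => ?_, fun w hw => ?_⟩
    · rw [← normAtPlace_apply_of_isReal hw]; exact h w
    · rw [← normAtPlace_apply_of_isComplex hw]; exact h w

variable [NumberField K]

/-- The elements of a fractional ideal whose absolute values at the infinite places are bounded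
by given numbers. -/
def boundedSections (I : (FractionalIdeal (𝓞 K)⁰ K)ˣ) (t : InfinitePlace K → ℝ≥0) : Set K :=
  {x | x ∈ (I : FractionalIdeal (𝓞 K)⁰ K) ∧ ∀ w, w x ≤ t w}

open scoped Classical in
theorem exists_normAtPlace_lt_of_mem_fundamentalDomain (I : (FractionalIdeal (𝓞 K)⁰ K)ˣ) :
    ∃ d : ℝ≥0, 0 < d ∧ ∀ x ∈ ZSpan.fundamentalDomain (fractionalIdealLatticeBasis K I),
      ∀ w, normAtPlace w x < d := by
  classical
  obtain ⟨d, hd0, hd⟩ := (ZSpan.fundamentalDomain_isBounded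
    (fractionalIdealLatticeBasis K I)).exists_pos_norm_lt
  refine ⟨NNReal.mk d hd0.le, hd0, fun x hx w => lt_of_le_of_lt ?_ (hd x hx)⟩
  rw [norm_eq_sup'_normAtPlace]
  exact Finset.le_sup' (fun w => normAtPlace w x) (Finset.mem_univ w)

theorem image_boundedSections (I : (FractionalIdeal (𝓞 K)⁰ K)ˣ) (t : InfinitePlace K → ℝ≥0) :
    mixedEmbedding K '' boundedSections K I t =
      {x | x ∈ Submodule.span ℤ (Set.range (fractionalIdealLatticeBasis K I)) ∧
        ∀ w, normAtPlace w x ≤ t w} := by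
  ext x
  constructor
  · rintro ⟨y, ⟨hy, hy'⟩, rfl⟩
    exact ⟨(mem_span_fractionalIdealLatticeBasis K I).2 ⟨y, hy, rfl⟩, by simpa using hy'⟩
  · rintro ⟨hx, hx'⟩
    obtain ⟨y, hy, rfl⟩ := (mem_span_fractionalIdealLatticeBasis K I).1 hx
    exact ⟨y, ⟨hy, by simpa using hx'⟩, rfl⟩

theorem finite_boundedSections (I : (FractionalIdeal (𝓞 K)⁰ K)ˣ) (t : InfinitePlace K → ℝ≥0) :
    (boundedSections K I t).Finite := by
  classical
  refine Set.Finite.of_finite_image ?_ (mixedEmbedding_injective K).injOn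
  rw [image_boundedSections]
  have hb : Bornology.IsBounded {x : mixedSpace K | ∀ w, normAtPlace w x ≤ t w} := by
    refine isBounded_iff_forall_norm_le.2 ⟨∑ w, (t w : ℝ), fun x hx => ?_⟩
    rw [norm_eq_sup'_normAtPlace]
    exact Finset.sup'_le _ _ fun w _ => (hx w).trans
      (Finset.single_le_sum (f := fun w => (t w : ℝ)) (fun _ _ => NNReal.coe_nonneg _)
        (Finset.mem_univ w))
  exact (ZSpan.setFinite_inter (fractionalIdealLatticeBasis K I) hb).subset
    fun x hx => ⟨hx.2, hx.1⟩

/-- The leading coefficient in the count of bounded sections. -/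
noncomputable def sectionDensity : ℝ :=
  2 ^ nrRealPlaces K * (2 * Real.pi) ^ nrComplexPlaces K / √|(discr K : ℝ)|

theorem sectionDensity_pos : 0 < sectionDensity K := by
  have : (0 : ℝ) < |(discr K : ℝ)| := abs_pos.2 (Int.cast_ne_zero.2 (discr_ne_zero K))
  unfold sectionDensity
  positivity

open MeasureTheory in
open scoped Classical in
theorem toReal_volume_convexBodyLT (f : InfinitePlace K → ℝ≥0) :
    (volume (convexBodyLT K f)).toReal =
      2 ^ nrRealPlaces K * Real.pi ^ nrComplexPlaces K * ∏ w, (f w : ℝ) ^ mult w := by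
  classical
  rw [convexBodyLT_volume]
  simp

open MeasureTheory in
open scoped Classical in
theorem toReal_volume_fundamentalDomain (I : (FractionalIdeal (𝓞 K)⁰ K)ˣ) :
    (volume (ZSpan.fundamentalDomain (fractionalIdealLatticeBasis K I))).toReal =
      (FractionalIdeal.absNorm I.1 : ℝ) *
        ((2⁻¹ : ℝ) ^ nrComplexPlaces K * √|(discr K : ℝ)|) := by
  classical
  have h0 : (0 : ℝ) ≤ (FractionalIdeal.absNorm I.1 : ℝ) :=
    Rat.cast_nonneg.2 (FractionalIdeal.absNorm_nonneg _)
  rw [volume_fundamentalDomain_fractionalIdealLatticeBasis, volume_fundamentalDomain_latticeBasis]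
  simp [h0, Int.norm_eq_abs]

/-- Box volume as density times covolume: the `2⁻¹ ^ s` of the covolume turns `π ^ s` into `(2π) ^
s`. -/
theorem toReal_volume_convexBodyLT_div (I : (FractionalIdeal (𝓞 K)⁰ K)ˣ)
    (f : InfinitePlace K → ℝ≥0) :
    2 ^ nrRealPlaces K * Real.pi ^ nrComplexPlaces K * ∏ w, (f w : ℝ) ^ mult w =
      sectionDensity K * (∏ w, (f w : ℝ) ^ mult w) / (FractionalIdeal.absNorm I.1 : ℝ) *
      ((FractionalIdeal.absNorm I.1 : ℝ) *
        ((2⁻¹ : ℝ) ^ nrComplexPlaces K * √|(discr K : ℝ)|)) := by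
  have h0 : (FractionalIdeal.absNorm I.1 : ℝ) ≠ 0 := by
    simp
  have : (0 : ℝ) < |(discr K : ℝ)| := abs_pos.2 (Int.cast_ne_zero.2 (discr_ne_zero K))
  have h1 : √|(discr K : ℝ)| ≠ 0 := by positivity
  unfold sectionDensity
  rw [mul_pow, inv_pow]
  field_simp

/-- Here `d` bounds the fundamental domain at every place: translates by counted points stay in the
box of radii `t + d`, and points of the box of radii `t - d` have their `ZSpan.floor` among the
counted points. -/
theorem ncard_boundedSections_bounds (I : (FractionalIdeal (𝓞 K)⁰ K)ˣ) :
    ∃ d : ℝ≥0, ∀ t : InfinitePlace K → ℝ≥0,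
      sectionDensity K * (∏ w, ((t w - d : ℝ≥0) : ℝ) ^ mult w) /
        (FractionalIdeal.absNorm I.1 : ℝ) ≤ (boundedSections K I t).ncard ∧
      (boundedSections K I t).ncard ≤
        sectionDensity K * (∏ w, ((t w + d : ℝ≥0) : ℝ) ^ mult w) /
          (FractionalIdeal.absNorm I.1 : ℝ) := by
  classical
  obtain ⟨d, hd0, hd⟩ := exists_normAtPlace_lt_of_mem_fundamentalDomain K I
  refine ⟨d, fun t => ?_⟩
  have hfin := finite_boundedSections K I t
  have hcard : (boundedSections K I t).ncard = ((hfin.image (mixedEmbedding K)).toFinset).card := by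
    rw [← Set.ncard_eq_toFinset_card _ (hfin.image (mixedEmbedding K)), Set.ncard_image_of_injective _ (mixedEmbedding_injective K)]
  have hmem : ∀ x, x ∈ (hfin.image (mixedEmbedding K)).toFinset ↔
      x ∈ Submodule.span ℤ (Set.range (fractionalIdealLatticeBasis K I)) ∧
        ∀ w, normAtPlace w x ≤ t w := by
    intro x
    rw [Set.Finite.mem_toFinset, image_boundedSections]; rfl
  set s := (hfin.image (mixedEmbedding K)).toFinset
  have hFtop : MeasureTheory.volume (ZSpan.fundamentalDomain (fractionalIdealLatticeBasis K I))
      ≠ ⊤ := (ZSpan.fundamentalDomain_isBounded _).measure_lt_top.ne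
  have hF0 : 0 < (MeasureTheory.volume
      (ZSpan.fundamentalDomain (fractionalIdealLatticeBasis K I))).toReal :=
    ENNReal.toReal_pos (ZSpan.measure_fundamentalDomain_ne_zero _) hFtop
  have hCtop : ∀ f : InfinitePlace K → ℝ≥0, MeasureTheory.volume (convexBodyLT K f) ≠ ⊤ := by
    intro f
    rw [convexBodyLT_volume]
    finiteness
  rw [hcard]
  constructor
  · have h := measure_le_card_mul_measure_fundamentalDomain (fractionalIdealLatticeBasis K I)
      MeasureTheory.volume (s := s) (D := convexBodyLT K (fun w => t w - d)) ?_
    · have h2 := ENNReal.toReal_mono (by finiteness) h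
      rw [ENNReal.toReal_mul, toReal_volume_convexBodyLT, toReal_volume_convexBodyLT_div K I,
        ← toReal_volume_fundamentalDomain, ENNReal.toReal_natCast] at h2
      exact le_of_mul_le_mul_right h2 hF0
    · intro z hz
      rw [mem_convexBodyLT_iff] at hz
      refine (hmem _).2 ⟨(ZSpan.floor _ z).2, fun w => ?_⟩
      have h1 := hz w
      have h2 := hd _ (ZSpan.fract_mem_fundamentalDomain (fractionalIdealLatticeBasis K I) z) w
      have h3 : (ZSpan.floor (fractionalIdealLatticeBasis K I) z : mixedSpace K) =
          z + -ZSpan.fract (fractionalIdealLatticeBasis K I) z := by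
        simp [ZSpan.fract_apply]
      rw [h3]
      refine (normAtPlace_add_le w _ _).trans ?_
      rw [normAtPlace_neg]
      have h0 := normAtPlace_nonneg w z
      -- Subtraction is truncated: if `t w ≤ d` the radius is `0` and the open box is empty.
      have hlt : d < t w := by
        by_contra! hle
        rw [tsub_eq_zero_of_le hle] at h1
        exact absurd h1 (not_lt.2 h0)
      rw [NNReal.coe_sub hlt.le] at h1
      linarith
  · have h := card_mul_measure_fundamentalDomain_le (fractionalIdealLatticeBasis K I)
      MeasureTheory.volume (s := s) (D := convexBodyLT K (fun w => t w + d))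
      (fun x hx => ((hmem x).1 hx).1) ?_
    · have h2 := ENNReal.toReal_mono (hCtop _) h
      rw [ENNReal.toReal_mul, toReal_volume_convexBodyLT, toReal_volume_convexBodyLT_div K I,
        ← toReal_volume_fundamentalDomain, ENNReal.toReal_natCast] at h2
      exact le_of_mul_le_mul_right h2 hF0
    · intro x hx y hy
      rw [mem_convexBodyLT_iff]
      intro w
      refine (normAtPlace_add_le w _ _).trans_lt ?_
      rw [NNReal.coe_add]
      exact add_lt_add_of_le_of_lt (((hmem x).1 hx).2 w) (hd y hy w)

end NumberField

/-! ### Fractional ideals described by valuations. -/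

namespace FractionalIdeal

open scoped nonZeroDivisors

variable {R K : Type*} [CommRing R] [IsDedekindDomain R] [Field K] [Algebra R K]
  [IsFractionRing R K]

theorem le_one_of_forall_count_nonneg {I : FractionalIdeal R⁰ K} (hI : I ≠ 0)
    (h : ∀ v : HeightOneSpectrum R, 0 ≤ count K v I) : I ≤ 1 := by
  rw [← finprod_heightOneSpectrum_factorization' K hI]
  refine finprod_induction (fun J : FractionalIdeal R⁰ K => J ≤ 1) le_rfl
    (fun J J' hJ hJ' => ?_) fun v => ?_
  · rw [le_one_iff_exists_coeIdeal] at hJ hJ' ⊢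
    obtain ⟨A, rfl⟩ := hJ
    obtain ⟨A', rfl⟩ := hJ'
    exact ⟨A * A', coeIdeal_mul _ _⟩
  · obtain ⟨n, hn⟩ := Int.eq_ofNat_of_zero_le (h v)
    rw [hn, zpow_natCast, ← coeIdeal_pow]
    exact coeIdeal_le_one

theorem le_of_forall_count_le {I J : FractionalIdeal R⁰ K} (hI : I ≠ 0) (hJ : J ≠ 0)
    (h : ∀ v : HeightOneSpectrum R, count K v J ≤ count K v I) : I ≤ J := by
  have h1 : I * J⁻¹ ≤ 1 := by
    refine le_one_of_forall_count_nonneg (mul_ne_zero hI (inv_ne_zero hJ)) fun v => ?_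
    rw [count_mul K v hI (inv_ne_zero hJ), count_inv]
    linarith [h v]
  calc I = I * J⁻¹ * J := by rw [mul_assoc, inv_mul_cancel₀ hJ, mul_one]
    _ ≤ 1 * J := mul_le_mul_left h1 J
    _ = J := one_mul J

theorem valuation_eq_exp_neg_count (v : HeightOneSpectrum R) {x : K} (hx : x ≠ 0) :
    v.valuation K x = WithZero.exp (-count K v (spanSingleton R⁰ x)) := by
  classical
  obtain ⟨n, d, hd, rfl⟩ := IsFractionRing.div_surjective (A := R) x
  have hd0 : d ≠ 0 := nonZeroDivisors.ne_zero hd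
  have hn0 : n ≠ 0 := by rintro rfl; simp at hx
  rw [count_well_defined K v (a := d) (J := Ideal.span {n})
    (spanSingleton_ne_zero_iff.2 hx) (by
      rw [coeIdeal_span_singleton, spanSingleton_mul_spanSingleton, div_eq_inv_mul])]
  rw [map_div₀, HeightOneSpectrum.valuation_of_algebraMap,
    HeightOneSpectrum.valuation_of_algebraMap, v.intValuation_if_neg hn0,
    v.intValuation_if_neg hd0, ← WithZero.exp_sub]
  congr 1
  ring

theorem mem_iff_forall_valuation_le {I : FractionalIdeal R⁰ K} (hI : I ≠ 0) (x : K) :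
    x ∈ I ↔ ∀ v : HeightOneSpectrum R, v.valuation K x ≤ WithZero.exp (-count K v I) := by
  rcases eq_or_ne x 0 with rfl | hx
  · simp [I.zero_mem]
  rw [← spanSingleton_le_iff_mem]
  simp_rw [valuation_eq_exp_neg_count _ hx, WithZero.exp_le_exp, neg_le_neg_iff]
  exact ⟨fun h v => count_mono K v (spanSingleton_ne_zero_iff.2 hx) h,
    le_of_forall_count_le (spanSingleton_ne_zero_iff.2 hx) hI⟩

end FractionalIdeal

/-! ### From ideles to fractional ideals. -/

namespace NumberField

open scoped nonZeroDivisors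

variable (K : Type*) [Field K] [NumberField K]

theorem norm_eq_absNorm_zpow {v : HeightOneSpectrum (𝓞 K)} {x : v.adicCompletion K} {n : ℤ}
    (hx : Valued.v x = WithZero.exp (-n)) : ‖x‖ = ((Ideal.absNorm v.asIdeal : ℝ) ^ n)⁻¹ := by
  rw [FinitePlace.norm_def, hx, WithZeroMulInt.toNNReal_neg_apply _ WithZero.exp_ne_zero]
  rw [NNReal.coe_zpow, ← zpow_neg]
  rfl

/-- The ideal is `∏ 𝔭 ^ ord_𝔭(a)`, a finite product since almost all components of an idele are
units. -/
theorem exists_fractionalIdeal_of_idele (a : (𝔸[K])ˣ) :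
    ∃ I : (FractionalIdeal (𝓞 K)⁰ K)ˣ,
      (∀ x : K, x ∈ (I : FractionalIdeal (𝓞 K)⁰ K) ↔
        ∀ v : HeightOneSpectrum (𝓞 K), v.valuation K x ≤ Valued.v ((a : 𝔸[K]).2 v)) ∧
      (FractionalIdeal.absNorm I.1 : ℝ) *
        ∏ᶠ v : HeightOneSpectrum (𝓞 K), ‖(a : 𝔸[K]).2 v‖ = 1 := by
  have hu : IsUnit (a : 𝔸[K]).2 := a.isUnit.map (RingHom.snd (InfiniteAdeleRing K) 𝔸ᶠ[K])
  obtain ⟨hne, hfin⟩ := FiniteAdeleRing.isUnit_iff.1 hu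
  let e : HeightOneSpectrum (𝓞 K) → ℤ := fun v => -WithZero.log (Valued.v ((a : 𝔸[K]).2 v))
  have he : ∀ v, Valued.v ((a : 𝔸[K]).2 v) = WithZero.exp (-e v) := fun v => by
    simp only [e, neg_neg]
    rw [WithZero.exp_log ((Valuation.ne_zero_iff _).2 (hne v))]
  have he0 : ∀ᶠ v in Filter.cofinite, e v = 0 := hfin.mono fun v hv => by
    simp [e, hv]
  set J : FractionalIdeal (𝓞 K)⁰ K :=
    ∏ᶠ v : HeightOneSpectrum (𝓞 K), (v.asIdeal : FractionalIdeal (𝓞 K)⁰ K) ^ e v with hJdef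
  have hsupp : (Function.mulSupport fun v : HeightOneSpectrum (𝓞 K) =>
      (v.asIdeal : FractionalIdeal (𝓞 K)⁰ K) ^ e v).Finite := by
    refine Set.Finite.subset (Filter.eventually_cofinite.1 he0) fun v hv h0 => hv ?_
    simp [h0]
  have hJN : (FractionalIdeal.absNorm J : ℝ) *
      ∏ᶠ v : HeightOneSpectrum (𝓞 K), ‖(a : 𝔸[K]).2 v‖ = 1 := by
    let φ : FractionalIdeal (𝓞 K)⁰ K →* ℝ :=
      ((Rat.castHom ℝ).toMonoidWithZeroHom.comp FractionalIdeal.absNorm).toMonoidHom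
    have hφ : φ J = ∏ᶠ v : HeightOneSpectrum (𝓞 K), (Ideal.absNorm v.asIdeal : ℝ) ^ e v := by
      rw [hJdef, φ.map_finprod hsupp]
      refine finprod_congr fun v => ?_
      simp [φ, map_zpow₀, FractionalIdeal.coeIdeal_absNorm]
    change φ J * _ = 1
    have hsupp' : (Function.mulSupport fun v : HeightOneSpectrum (𝓞 K) =>
        (Ideal.absNorm v.asIdeal : ℝ) ^ e v).Finite := by
      refine Set.Finite.subset (Filter.eventually_cofinite.1 he0) fun v hv h0 => hv ?_
      simp [h0]
    rw [hφ, ← finprod_mul_distrib hsupp' (hasFiniteMulSupport_idele K a)]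
    refine finprod_eq_one_of_forall_eq_one fun v => ?_
    rw [norm_eq_absNorm_zpow K (he v)]
    refine mul_inv_cancel₀ (zpow_ne_zero _ ?_)
    exact_mod_cast HeightOneSpectrum.absNorm_ne_zero v
  have hJ0 : J ≠ 0 := by
    intro h
    rw [h] at hJN
    simp at hJN
  refine ⟨Units.mk0 J hJ0, fun x => ?_, hJN⟩
  rw [Units.val_mk0, FractionalIdeal.mem_iff_forall_valuation_le hJ0]
  refine forall_congr' fun v => ?_
  rw [he v, FractionalIdeal.count_finprod K v e he0]

theorem ideleSections_eq_boundedSections (a : (𝔸[K])ˣ) :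
    ∃ (I : (FractionalIdeal (𝓞 K)⁰ K)ˣ) (t : InfinitePlace K → NNReal),
      (∀ w, 0 < t w) ∧ ideleSections K a = boundedSections K I t ∧
      ∏ w, (t w : ℝ) ^ w.mult = FractionalIdeal.absNorm I.1 * ideleNorm K a := by
  obtain ⟨I, hI, hN⟩ := exists_fractionalIdeal_of_idele K a
  have h1 : ∀ w : InfinitePlace K, (a : 𝔸[K]).1 w * ((a⁻¹ : (𝔸[K])ˣ) : 𝔸[K]).1 w = 1 := fun w =>
    congrFun (congrArg Prod.fst a.mul_inv) w
  have h2 : ∀ v : HeightOneSpectrum (𝓞 K),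
      (a : 𝔸[K]).2 v * ((a⁻¹ : (𝔸[K])ˣ) : 𝔸[K]).2 v = 1 := fun v =>
    congrArg (fun x : 𝔸[K] => x.2 v) a.mul_inv
  have h1pos : ∀ w : InfinitePlace K, 0 < ‖(a : 𝔸[K]).1 w‖ := fun w =>
    norm_pos_iff.2 (left_ne_zero_of_mul_eq_one (h1 w))
  refine ⟨I, fun w => ‖(a : 𝔸[K]).1 w‖₊, h1pos, ?_, ?_⟩
  · ext x
    have hinf : ∀ w : InfinitePlace K,
        ‖(algebraMap K 𝔸[K] x * ((a⁻¹ : (𝔸[K])ˣ) : 𝔸[K])).1 w‖ ≤ 1 ↔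
          w x ≤ ‖(a : 𝔸[K]).1 w‖ := fun w => by
      have h3 : (algebraMap K 𝔸[K] x * ((a⁻¹ : (𝔸[K])ˣ) : 𝔸[K])).1 w =
        (x : w.Completion) * ((a : 𝔸[K]).1 w)⁻¹ := by
        rw [← eq_inv_of_mul_eq_one_right (h1 w)]; rfl
      rw [h3, norm_mul, norm_inv, ← div_eq_mul_inv, div_le_one (h1pos w)]
      exact Iff.of_eq (congrArg (· ≤ _) (InfinitePlace.Completion.norm_coe w _))
    have hfin : ∀ v : HeightOneSpectrum (𝓞 K),
        (algebraMap K 𝔸[K] x * ((a⁻¹ : (𝔸[K])ˣ) : 𝔸[K])).2 v ∈ v.adicCompletionIntegers K ↔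
          v.valuation K x ≤ Valued.v ((a : 𝔸[K]).2 v) := fun v => by
      have h3 : (algebraMap K 𝔸[K] x * ((a⁻¹ : (𝔸[K])ˣ) : 𝔸[K])).2 v =
        (x : v.adicCompletion K) * ((a : 𝔸[K]).2 v)⁻¹ := by
        rw [← eq_inv_of_mul_eq_one_right (h2 v)]; rfl
      have h0 : (Valued.v ((a : 𝔸[K]).2 v)) ≠ 0 :=
        (Valuation.ne_zero_iff _).2 (left_ne_zero_of_mul_eq_one (h2 v))
      rw [h3, HeightOneSpectrum.mem_adicCompletionIntegers, map_mul, map_inv₀,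
        ← div_eq_mul_inv, div_le_one₀ (zero_lt_iff.2 h0),
        HeightOneSpectrum.valuedAdicCompletion_eq_valuation']
    change ((∀ w, _) ∧ ∀ v, _) ↔ _
    rw [forall_congr' hinf, forall_congr' hfin, ← hI x]
    exact and_comm
  · rw [ideleNorm, mul_left_comm, hN, mul_one]
    rfl

end NumberField

/-! ### Error term for balanced boxes. -/

theorem one_add_pow_le_one_add_mul {x : ℝ} (hx : 0 ≤ x) (n : ℕ) :
    (1 + x) ^ n ≤ 1 + n * x * (1 + x) ^ n := by
  induction n with
  | zero => simp
  | succ n ih =>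
    have h1 : (0 : ℝ) ≤ (1 + x) ^ n := by positivity
    have h2 : 0 ≤ ((n : ℝ) + 1) * x * ((1 + x) ^ n * x) := by positivity
    rw [pow_succ]
    push_cast
    nlinarith

namespace NumberField

open InfinitePlace mixedEmbedding Module
open scoped nonZeroDivisors NNReal

variable (K : Type*) [Field K] [NumberField K]

theorem absNorm_units_pos (I : (FractionalIdeal (𝓞 K)⁰ K)ˣ) :
    (0 : ℝ) < (FractionalIdeal.absNorm I.1 : ℝ) := by
  refine Rat.cast_pos.2 ((FractionalIdeal.absNorm_nonneg _).lt_of_ne' ?_)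
  simp

variable {K} in
theorem prod_mul_const_pow_mult (f : InfinitePlace K → ℝ) (c : ℝ) :
    ∏ w, (f w * c) ^ mult w = (∏ w, f w ^ mult w) * c ^ finrank ℚ K := by
  simp_rw [mul_pow, Finset.prod_mul_distrib, Finset.prod_pow_eq_pow_sum, sum_mult_eq]

/-- With `x = d / (c N^(1/n))`, balance gives `d ≤ t w * x`, so the two bounds differ from the main
term by factors `(1 ± x)^n = 1 + O(x)`. The bound `δ ≤ N` keeps `x ≤ x₀`, which makes the implied
constant uniform. -/
theorem abs_ncard_boundedSections_sub_le (I : (FractionalIdeal (𝓞 K)⁰ K)ˣ) {c δ : ℝ}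
    (hc : 0 < c) (hδ : 0 < δ) :
    ∃ C : ℝ, ∀ (t : InfinitePlace K → ℝ≥0) (N : ℝ), δ ≤ N →
      ∏ w, (t w : ℝ) ^ mult w = FractionalIdeal.absNorm I.1 * N →
      (∀ w, c * N ^ (1 / (finrank ℚ K : ℝ)) ≤ t w) →
      |((boundedSections K I t).ncard : ℝ) - sectionDensity K * N| ≤
        C * N ^ (1 - 1 / (finrank ℚ K : ℝ)) := by
  obtain ⟨d, hd⟩ := ncard_boundedSections_bounds K I
  set n := finrank ℚ K with hn
  have hn1 : (1 : ℝ) ≤ n := by exact_mod_cast finrank_pos (R := ℚ) (M := K)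
  have hA := absNorm_units_pos K I
  have hκ := sectionDensity_pos K
  set κ := sectionDensity K
  set A : ℝ := (FractionalIdeal.absNorm I.1 : ℝ)
  set x₀ : ℝ := d / (c * δ ^ (1 / (n : ℝ)))
  refine ⟨κ * (n * (d / c) * (1 + x₀) ^ n), fun t N hN hprod ht => ?_⟩
  have hN0 : 0 < N := hδ.trans_le hN
  set T : ℝ := N ^ (1 / (n : ℝ)) with hT
  have hT0 : 0 < T := Real.rpow_pos_of_pos hN0 _
  have hδT : δ ^ (1 / (n : ℝ)) ≤ T := Real.rpow_le_rpow hδ.le hN (by positivity)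
  have hδ0 : 0 < δ ^ (1 / (n : ℝ)) := Real.rpow_pos_of_pos hδ _
  have hd0 : (0 : ℝ) ≤ d := d.coe_nonneg
  set x : ℝ := d / (c * T) with hx
  have hx0 : 0 ≤ x := by positivity
  have hxx₀ : x ≤ x₀ := by
    simp only [x, x₀]
    gcongr
  have hdx : ∀ w, (d : ℝ) ≤ t w * x := fun w => by
    calc (d : ℝ) = c * T * x := by rw [hx]; field_simp
      _ ≤ t w * x := by gcongr; exact ht w
  have hNT : N ^ (1 - 1 / (n : ℝ)) = N / T := by rw [Real.rpow_sub hN0, Real.rpow_one]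
  have herr : κ * N * (n * x * (1 + x₀) ^ n) =
      κ * (n * (d / c) * (1 + x₀) ^ n) * N ^ (1 - 1 / (n : ℝ)) := by
    rw [hNT, hx]
    field_simp
  rw [← herr]
  obtain ⟨hlow, hup⟩ := hd t
  have hup2 : ((boundedSections K I t).ncard : ℝ) ≤ κ * N * (1 + x) ^ n := by
    refine hup.trans ?_
    have : ∏ w, ((t w + d : ℝ≥0) : ℝ) ^ mult w ≤ A * N * (1 + x) ^ n := by
      rw [← hprod, hn, ← prod_mul_const_pow_mult]
      refine Finset.prod_le_prod (fun _ _ => by positivity) fun w _ => ?_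
      gcongr
      rw [NNReal.coe_add]
      linarith [hdx w]
    calc κ * (∏ w, ((t w + d : ℝ≥0) : ℝ) ^ mult w) / A ≤ κ * (A * N * (1 + x) ^ n) / A := by gcongr
      _ = κ * N * (1 + x) ^ n := by field_simp
  have hlow2 : κ * N * (1 - n * x) ≤ (boundedSections K I t).ncard := by
    rcases le_or_gt x 1 with hx1 | hx1
    · refine le_trans ?_ hlow
      have : A * N * (1 - x) ^ n ≤ ∏ w, ((t w - d : ℝ≥0) : ℝ) ^ mult w := by
        rw [← hprod, hn, ← prod_mul_const_pow_mult]
        refine Finset.prod_le_prod (fun w _ => pow_nonneg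
          (mul_nonneg (t w).coe_nonneg (sub_nonneg.2 hx1)) _) fun w _ => ?_
        refine pow_le_pow_left₀ (mul_nonneg (t w).coe_nonneg (sub_nonneg.2 hx1)) ?_ _
        have h1 := hdx w
        have h2 : (t w : ℝ) * x ≤ t w := mul_le_of_le_one_right (t w).coe_nonneg hx1
        rw [NNReal.coe_sub (NNReal.coe_le_coe.1 (h1.trans h2))]
        linarith [mul_one_sub (t w : ℝ) x]
      have hb : 1 - n * x ≤ (1 - x) ^ n := by
        have := one_add_mul_le_pow (a := -x) (by linarith) n
        rw [← sub_eq_add_neg] at this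
        linarith
      calc κ * N * (1 - n * x) ≤ κ * N * (1 - x) ^ n := by gcongr
        _ = κ * (A * N * (1 - x) ^ n) / A := by field_simp
        _ ≤ _ := by gcongr
    -- For `x > 1` the claimed lower bound is negative, since `n ≥ 1`.
    · refine le_trans (mul_nonpos_of_nonneg_of_nonpos (by positivity) ?_) (Nat.cast_nonneg _)
      nlinarith
  have h1 : n * x * (1 + x) ^ n ≤ n * x * (1 + x₀) ^ n := by gcongr
  have h2 : n * x ≤ n * x * (1 + x₀) ^ n :=
    le_mul_of_one_le_right (by positivity) (one_le_pow₀ (by linarith))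
  have h3 := one_add_pow_le_one_add_mul hx0 n
  have hκN : 0 ≤ κ * N := by positivity
  rw [abs_le]
  constructor
  · nlinarith [mul_le_mul_of_nonneg_left h2 hκN]
  · nlinarith [mul_le_mul_of_nonneg_left (h3.trans (add_le_add_right h1 1)) hκN]

/-! ### Minkowski reduction to finitely many balanced cases. -/

theorem finite_units_inv_coeIdeal_absNorm_le (m : ℕ) :
    {J : (FractionalIdeal (𝓞 K)⁰ K)ˣ | ∃ A : Ideal (𝓞 K), Ideal.absNorm A ≤ m ∧
      (A : FractionalIdeal (𝓞 K)⁰ K) = (J⁻¹ : (FractionalIdeal (𝓞 K)⁰ K)ˣ)}.Finite := by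
  refine (((Ideal.finite_setOfPred_absNorm_le (S := 𝓞 K) m).image
    (fun A : Ideal (𝓞 K) => (A : FractionalIdeal (𝓞 K)⁰ K))).preimage
    (f := fun J : (FractionalIdeal (𝓞 K)⁰ K)ˣ =>
      ((J⁻¹ : (FractionalIdeal (𝓞 K)⁰ K)ˣ) : FractionalIdeal (𝓞 K)⁰ K)) ?_).subset ?_
  · exact (Units.val_injective.comp inv_injective).injOn
  · rintro J ⟨A, hA, hAJ⟩
    exact ⟨A, hA, hAJ⟩

theorem exists_mem_boundedSections_of_lt (I : (FractionalIdeal (𝓞 K)⁰ K)ˣ)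
    (f : InfinitePlace K → ℝ≥0)
    (h : FractionalIdeal.absNorm I.1 * (2 : ℝ) ^ finrank ℚ K <
      sectionDensity K * ∏ w, (f w : ℝ) ^ mult w) :
    ∃ α ∈ boundedSections K I f, α ≠ 0 := by
  classical
  have hFtop : MeasureTheory.volume (ZSpan.fundamentalDomain (fractionalIdealLatticeBasis K I))
      ≠ ⊤ := (ZSpan.fundamentalDomain_isBounded _).measure_lt_top.ne
  have hF0 : 0 < (MeasureTheory.volume
      (ZSpan.fundamentalDomain (fractionalIdealLatticeBasis K I))).toReal :=
    ENNReal.toReal_pos (ZSpan.measure_fundamentalDomain_ne_zero _) hFtop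
  have hCtop : MeasureTheory.volume (convexBodyLT K f) ≠ ⊤ := by
    rw [convexBodyLT_volume]
    finiteness
  obtain ⟨α, hα, hα0, hlt⟩ := exists_ne_zero_mem_ideal_lt K I (f := f) (by
    rw [← ENNReal.toReal_lt_toReal (minkowskiBound_lt_top K I).ne hCtop,
      toReal_volume_convexBodyLT, toReal_volume_convexBodyLT_div K I,
      ← toReal_volume_fundamentalDomain, minkowskiBound, ENNReal.toReal_mul, mul_comm]
    gcongr
    rw [lt_div_iff₀ (absNorm_units_pos K I), mixedEmbedding.finrank]
    simpa [mul_comm] using h)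
  exact ⟨α, ⟨hα, fun w => (hlt w).le⟩, hα0⟩

variable {K} in
theorem exists_coeIdeal_eq_spanSingleton_mul_inv {I : (FractionalIdeal (𝓞 K)⁰ K)ˣ} {α : K}
    (hα : α ∈ (I : FractionalIdeal (𝓞 K)⁰ K)) (hα0 : α ≠ 0) :
    ∃ A : Ideal (𝓞 K), (A : FractionalIdeal (𝓞 K)⁰ K) =
        FractionalIdeal.spanSingleton (𝓞 K)⁰ α * (I⁻¹ : (FractionalIdeal (𝓞 K)⁰ K)ˣ) ∧
      0 < Ideal.absNorm A ∧
      (Ideal.absNorm A : ℝ) * FractionalIdeal.absNorm I.1 = ∏ w : InfinitePlace K, w α ^ mult w := by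
  have hle : FractionalIdeal.spanSingleton (𝓞 K)⁰ α *
      (I⁻¹ : (FractionalIdeal (𝓞 K)⁰ K)ˣ) ≤ 1 := by
    rw [← I.mul_inv]
    exact mul_le_mul_left (FractionalIdeal.spanSingleton_le_iff_mem.2 hα) _
  obtain ⟨A, hA⟩ := FractionalIdeal.le_one_iff_exists_coeIdeal.1 hle
  have hA2 : (A : FractionalIdeal (𝓞 K)⁰ K) * I = FractionalIdeal.spanSingleton (𝓞 K)⁰ α := by
    rw [hA, mul_assoc, Units.inv_mul, mul_one]
  have hN := congrArg (fun J => ((FractionalIdeal.absNorm J : ℚ) : ℝ)) hA2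
  simp only [map_mul, FractionalIdeal.coeIdeal_absNorm, Rat.cast_mul, Rat.cast_natCast,
    FractionalIdeal.absNorm_span_singleton, ← prod_eq_abs_norm] at hN
  refine ⟨A, hA, ?_, hN⟩
  rcases Nat.eq_zero_or_pos (Ideal.absNorm A) with h0 | h0
  · rw [h0, Nat.cast_zero, zero_mul] at hN
    exact absurd hN.symm (Finset.prod_ne_zero_iff.2 fun w _ => pow_ne_zero _
      ((map_ne_zero w).2 hα0))
  · exact h0

/-- Every pair of a fractional ideal and a tuple of bounds at the infinite places becomes, after
multiplication by a suitable element of `K`, balanced, with the ideal in a finite set. -/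
theorem exists_finite_balanced_representatives :
    ∃ F : Set (FractionalIdeal (𝓞 K)⁰ K)ˣ, F.Finite ∧ ∃ c : ℝ, 0 < c ∧
      ∀ (I : (FractionalIdeal (𝓞 K)⁰ K)ˣ) (t : InfinitePlace K → ℝ≥0) (N : ℝ),
        0 < N → ∏ w, (t w : ℝ) ^ mult w = FractionalIdeal.absNorm I.1 * N →
        ∃ α : K, α ≠ 0 ∧ ∃ J ∈ F,
          (J : FractionalIdeal (𝓞 K)⁰ K) = FractionalIdeal.spanSingleton (𝓞 K)⁰ α⁻¹ * I ∧
          ∀ w, c * N ^ (1 / (finrank ℚ K : ℝ)) * w α ≤ t w := by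
  have hn0 : finrank ℚ K ≠ 0 := finrank_pos.ne'
  set n := finrank ℚ K with hn
  have hκ := sectionDensity_pos K
  set κ := sectionDensity K
  -- Chosen so that `κ * M ^ n` exceeds the Minkowski threshold `2 ^ n`.
  set M : ℝ≥0 := 1 + 2 ^ n / NNReal.mk κ hκ.le with hM
  have hM1 : 1 ≤ M := le_self_add
  have hMκ : (2 : ℝ) ^ n < κ * (M : ℝ) ^ n := by
    calc (2 : ℝ) ^ n = κ * (2 ^ n / κ) := by field_simp
      _ < κ * M := by
        gcongr
        rw [hM]
        simp
      _ ≤ κ * (M : ℝ) ^ n := by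
        gcongr
        exact le_self_pow₀ (by exact_mod_cast hM1) hn0
  have hM0 : (0 : ℝ) < M := by positivity
  refine ⟨_, finite_units_inv_coeIdeal_absNorm_le K ⌊(M : ℝ) ^ n⌋₊, (M : ℝ)⁻¹, by positivity,
    fun I t N hN hprod => ?_⟩
  have hA := absNorm_units_pos K I
  set T : ℝ := N ^ (1 / (n : ℝ)) with hT
  have hT0 : 0 < T := Real.rpow_pos_of_pos hN _
  have hTn : T ^ n = N := by
    rw [hT, one_div, Real.rpow_inv_natCast_pow hN.le hn0]
  have hf : ∏ w, ((t w * (M / NNReal.mk T hT0.le) : ℝ≥0) : ℝ) ^ mult w =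
      FractionalIdeal.absNorm I.1 * (M : ℝ) ^ n := by
    simp only [NNReal.coe_mul]
    rw [prod_mul_const_pow_mult, hprod, ← hn, NNReal.coe_div, div_pow, NNReal.coe_mk, hTn]
    field_simp
  -- The box is rescaled to volume just proportional to `absNorm I`. Its point `α` satisfies `w α ≤
  -- t w * M / T`, which is balance with `c = M⁻¹`; and `α I⁻¹` is integral of norm at most `M ^ n`,
  -- so its inverse `J` lies in the finite set.
  obtain ⟨α, ⟨hα, hle⟩, hα0⟩ := exists_mem_boundedSections_of_lt K I
    (fun w => t w * (M / NNReal.mk T hT0.le)) (by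
      rw [hf, ← hn, mul_left_comm]
      gcongr)
  obtain ⟨A, hAJ, -, hAN⟩ := exists_coeIdeal_eq_spanSingleton_mul_inv hα hα0
  have hs : FractionalIdeal.spanSingleton (𝓞 K)⁰ α⁻¹ ≠ 0 :=
    FractionalIdeal.spanSingleton_ne_zero_iff.2 (inv_ne_zero hα0)
  refine ⟨α, hα0, Units.mk0 _ (mul_ne_zero hs I.ne_zero), ⟨A, ?_, ?_⟩, rfl, fun w => ?_⟩
  · refine Nat.le_floor (le_of_mul_le_mul_right ?_ hA)
    rw [hAN, mul_comm _ (FractionalIdeal.absNorm I.1 : ℝ), ← hf]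
    exact Finset.prod_le_prod (fun w _ => pow_nonneg (apply_nonneg _ _) _)
      fun w _ => pow_le_pow_left₀ (apply_nonneg _ _) (hle w) _
  · rw [hAJ, Units.val_inv_eq_inv_val, Units.val_inv_eq_inv_val, Units.val_mk0, mul_inv,
      FractionalIdeal.spanSingleton_inv, inv_inv]
  · have := hle w
    rw [NNReal.coe_mul, NNReal.coe_div, NNReal.coe_mk] at this
    calc (M : ℝ)⁻¹ * T * w α ≤ (M : ℝ)⁻¹ * T * (t w * (M / T)) := by gcongr
      _ = t w := by field_simp

variable {K} in
theorem ncard_boundedSections_eq {I J : (FractionalIdeal (𝓞 K)⁰ K)ˣ} {α : K} (hα : α ≠ 0)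
    (hJ : (J : FractionalIdeal (𝓞 K)⁰ K) = FractionalIdeal.spanSingleton (𝓞 K)⁰ α⁻¹ * I)
    (t : InfinitePlace K → ℝ≥0) :
    (boundedSections K I t).ncard =
      (boundedSections K J fun w => t w / NNReal.mk (w α) (apply_nonneg w α)).ncard := by
  have : (boundedSections K J fun w => t w / NNReal.mk (w α) (apply_nonneg w α)) =
      (fun x => α⁻¹ * x) '' boundedSections K I t := by
    ext y
    have hw : ∀ w : InfinitePlace K, 0 < w α := fun w => w.pos_iff.2 hα
    simp only [boundedSections, hJ, FractionalIdeal.mem_singleton_mul, Set.mem_image,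
      NNReal.coe_div, NNReal.coe_mk]
    constructor
    · rintro ⟨⟨x, hx, rfl⟩, h⟩
      refine ⟨x, ⟨hx, fun w => ?_⟩, rfl⟩
      have := h w
      rwa [map_mul, map_inv₀, ← div_eq_inv_mul, div_le_div_iff_of_pos_right (hw w)] at this
    · rintro ⟨x, ⟨hx, h⟩, rfl⟩
      refine ⟨⟨x, hx, rfl⟩, fun w => ?_⟩
      rw [map_mul, map_inv₀, ← div_eq_inv_mul, div_le_div_iff_of_pos_right (hw w)]
      exact h w
  rw [this, Set.ncard_image_of_injective _ (mul_right_injective₀ (inv_ne_zero hα))]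

theorem exists_abs_ncard_boundedSections_sub_le {δ : ℝ} (hδ : 0 < δ) :
    ∃ C : ℝ, ∀ (I : (FractionalIdeal (𝓞 K)⁰ K)ˣ) (t : InfinitePlace K → ℝ≥0) (N : ℝ), δ ≤ N →
      ∏ w, (t w : ℝ) ^ mult w = FractionalIdeal.absNorm I.1 * N →
      |((boundedSections K I t).ncard : ℝ) - sectionDensity K * N| ≤
        C * N ^ (1 - 1 / (finrank ℚ K : ℝ)) := by
  obtain ⟨F, hF, c, hc, hrep⟩ := exists_finite_balanced_representatives K
  choose C hC using fun I => abs_ncard_boundedSections_sub_le K I hc hδ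
  -- Finiteness of `F` makes the constant independent of the ideal.
  obtain ⟨C', hC'⟩ := (hF.image C).bddAbove
  refine ⟨C', fun I t N hN hprod => ?_⟩
  have hN0 := hδ.trans_le hN
  obtain ⟨α, hα0, J, hJF, hJ, hbal⟩ := hrep I t N hN0 hprod
  rw [ncard_boundedSections_eq hα0 hJ]
  have hw : ∀ w : InfinitePlace K, 0 < w α := fun w => w.pos_iff.2 hα0
  refine (hC J _ N hN ?_ fun w => ?_).trans (mul_le_mul_of_nonneg_right
    (hC' ⟨J, hJF, rfl⟩) (Real.rpow_nonneg hN0.le _))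
  · rw [hJ, ← FractionalIdeal.spanSingleton_inv, map_mul, map_inv₀,
      FractionalIdeal.absNorm_span_singleton, Rat.cast_mul, mul_assoc, ← hprod, Rat.cast_inv,
      ← prod_eq_abs_norm]
    simp only [NNReal.coe_div, NNReal.coe_mk, div_pow, Finset.prod_div_distrib]
    rw [div_eq_inv_mul]
  · rw [NNReal.coe_div, NNReal.coe_mk, le_div_iff₀ (hw w)]
    exact hbal w

variable {K} in
-- A nonzero `α ∈ I` has `|N(α)| ≥ absNorm I`, more than a box with `N < 1` allows.
theorem boundedSections_eq_singleton {I : (FractionalIdeal (𝓞 K)⁰ K)ˣ}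
    {t : InfinitePlace K → ℝ≥0} {N : ℝ} (hN : N < 1)
    (hprod : ∏ w, (t w : ℝ) ^ mult w = FractionalIdeal.absNorm I.1 * N) :
    boundedSections K I t = {0} := by
  refine Set.eq_singleton_iff_unique_mem.2 ⟨⟨FractionalIdeal.zero_mem _, by simp⟩, ?_⟩
  rintro α ⟨hα, hle⟩
  by_contra hα0
  obtain ⟨A, -, hA0, hA⟩ := exists_coeIdeal_eq_spanSingleton_mul_inv hα hα0
  have h1 : ∏ w : InfinitePlace K, w α ^ mult w ≤ ∏ w, (t w : ℝ) ^ mult w :=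
    Finset.prod_le_prod (fun w _ => pow_nonneg (apply_nonneg _ _) _)
      fun w _ => pow_le_pow_left₀ (apply_nonneg _ _) (hle w) _
  have h2 : (1 : ℝ) ≤ Ideal.absNorm A := by exact_mod_cast hA0
  rw [← hA, hprod] at h1
  nlinarith [absNorm_units_pos K I]

end NumberField

theorem mainTheorem1 (K : Type*) [Field K] [NumberField K] :
    (∀ a : (𝔸[K])ˣ, (ideleSections K a).Finite) ∧
    ∀ δ : ℝ, 0 < δ → ∃ C : ℝ, ∀ a : (𝔸[K])ˣ,
      (δ ≤ ideleNorm K a ∨ Module.finrank ℚ K = 1) →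
        |((ideleSections K a).ncard : ℝ) -
            2 ^ InfinitePlace.nrRealPlaces K * (2 * Real.pi) ^ InfinitePlace.nrComplexPlaces K /
              √|(discr K : ℝ)| * ideleNorm K a|
          ≤ C * ideleNorm K a ^ (1 - 1 / (Module.finrank ℚ K : ℝ)) := by
  refine ⟨fun a => ?_, fun δ hδ => ?_⟩
  · obtain ⟨I, t, -, h, -⟩ := ideleSections_eq_boundedSections K a
    rw [h]
    exact finite_boundedSections K I t
  -- With threshold `min δ 1`, the ideles left over have norm below `1` and force `n = 1`.
  obtain ⟨C, hC⟩ := exists_abs_ncard_boundedSections_sub_le K (δ := min δ 1) (by positivity)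
  -- In the leftover case the count is `1` and the exponent `1 - 1/n` is `0`, so `1 + sectionDensity
  -- K` suffices.
  refine ⟨max C (1 + sectionDensity K), fun a ha => ?_⟩
  obtain ⟨I, t, ht, h, hprod⟩ := ideleSections_eq_boundedSections K a
  have hN0 : 0 < ideleNorm K a := by
    have : 0 < ∏ w, (t w : ℝ) ^ w.mult := Finset.prod_pos fun w _ => pow_pos (ht w) _
    rw [hprod] at this
    exact pos_of_mul_pos_right this (absNorm_units_pos K I).le
  change |_ - sectionDensity K * _| ≤ _
  rw [h]
  rcases le_or_gt (min δ 1) (ideleNorm K a) with hle | hlt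
  · exact (hC I t _ hle hprod).trans (mul_le_mul_of_nonneg_right (le_max_left _ _)
      (Real.rpow_nonneg hN0.le _))
  · have hn : Module.finrank ℚ K = 1 := ha.resolve_left fun h' =>
      absurd (min_le_left δ 1) (not_le.2 (hlt.trans_le' h'))
    have hN1 : ideleNorm K a < 1 := hlt.trans_le (min_le_right _ _)
    rw [boundedSections_eq_singleton hN1 hprod, Set.ncard_singleton, hn]
    have hκ := sectionDensity_pos K
    have hκN : sectionDensity K * ideleNorm K a ≤ sectionDensity K :=
      mul_le_of_le_one_right hκ.le hN1.le
    have hκN0 : 0 < sectionDensity K * ideleNorm K a := mul_pos hκ hN0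
    simp only [Nat.cast_one, div_one, sub_self, Real.rpow_zero, mul_one]
    refine le_trans ?_ (le_max_right _ _)
    rw [abs_le]
    constructor <;> linarith
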